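/- Let $1<p<\infty$, $0<r\le\infty$, $p\le s\le\infty$ with $r^{-1}+s^{-1}<1$, and put $\alpha=(1-r^{-1}-s^{-1})^{-1}$ (with $1/\infty=0$). For a measurable $f:\mathbb{R}_+\to\mathbb{C}$, where $\mathbb{R}_+=[0,\infty)$ carries Lebesgue measure, and for $0<r<\infty$ let $$\|f\|_{r,w}=\sup_{t>0}\bigl(t^{r}\,|\{x\in\mathbb{R}_+:|f(x)|>t\}|\bigr)^{1/r},$$ let $\|f\|_{\infty,w}=\|f\|_{L_\infty(\mathbb{R}_+)}$, and let $L_{r,w}(\mathbb{R}_+)$ be the space of all measurable $f$ with $\|f\|_{r,w}<\infty$. For $q=ab$ with $a\in L_{r,w}(\mathbb{R}_+)$ and $b\in L_{s,w}(\mathbb{R}_+)$, let $H$ be the Schrödinger operator $-d^2/dx^2+q$ in $L_p(\mathbb{R}_+)$ with Dirichlet boundary condition: its domain consists of all $u\in L_p(\mathbb{R}_+)$ such that $u$ and $u'$ are absolutely continuous on every interval $[0,R]$, $u(0)=0$ and $-u''+qu\in L_p(\mathbb{R}_+)$, and $Hu=-u''+qu$. Then there is a constant $C>0$ depending only on $p$,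 $r$ and $s$ such that, for all such $a$ and $b$, every eigenvalue $\lambda=|\lambda|e^{i\theta}\in\mathbb{C}\setminus\mathbb{R}_+$ $(0<\theta<2\pi)$ of $H$ satisfies $$|\lambda|^{1+\alpha}\le C\,(\alpha\sin(\theta/2))^{-2}\,\|a\|_{r,w}^{2\alpha}\,\|b\|_{s,w}^{2\alpha}.$$ -/

import Mathlib

open MeasureTheory Set
open scoped ENNReal

namespace HalfLine

/-- Lebesgue measure on the half-line `(0, ∞)`. -/
noncomputable abbrev vol : Measure ℝ := volume.restrict (Ioi (0 : ℝ))

/-- The distribution function `t ↦ |{x > 0 : |f x| > t}|`. -/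
noncomputable def distrib (f : ℝ → ℂ) (t : ℝ) : ℝ≥0∞ := vol {x | t < ‖f x‖}

/-- The weak Lebesgue quasi-norm `sup_{t > 0} (t ^ r * distrib f t) ^ (1 / r)` on the half-line,
with values in `[0, ∞]`; for `r = ∞` the weak space is `L_∞`, so it is the essential supremum. -/
noncomputable def wnorm (r : ℝ≥0∞) (f : ℝ → ℂ) : ℝ≥0∞ :=
  if r = ∞ then eLpNorm f ∞ vol
  else ⨆ (t : ℝ) (_ : 0 < t), (ENNReal.ofReal t ^ r.toReal * distrib f t) ^ (1 / r.toReal)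

/-- Membership in the weak Lebesgue space over the half-line. -/
def MemWeakLp (r : ℝ≥0∞) (f : ℝ → ℂ) : Prop :=
  AEMeasurable f vol ∧ wnorm r f < ∞

/-- `IsDirichletPair q u g`: the function `u` is `C¹` on `[0, ∞)`, `u` and `u'` are absolutely
continuous on every `[0, R]`, `u 0 = 0`, and `g = - u'' + q u` almost everywhere on `(0, ∞)`.
Here `v` is `u'` and `w` is `u''`. -/
def IsDirichletPair (q u g : ℝ → ℂ) : Prop :=
  ∃ v w : ℝ → ℂ,
    (∀ R : ℝ, 0 < R → AbsolutelyContinuousOnInterval u 0 R) ∧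
    (∀ R : ℝ, 0 < R → AbsolutelyContinuousOnInterval v 0 R) ∧
    (∀ x ∈ Ici (0 : ℝ), HasDerivWithinAt u (v x) (Ici 0) x) ∧
    (∀ᵐ x ∂vol, HasDerivAt v (w x) x) ∧
    u 0 = 0 ∧
    (∀ᵐ x ∂vol, g x = - w x + q x * u x)

/-- The graph, in `L_p × L_p`, of the Dirichlet realization of `- d²/dx² + q`. -/
noncomputable def dirichletGraph (p : ℝ≥0∞) (q : ℝ → ℂ) :
    Submodule ℂ (Lp ℂ p vol × Lp ℂ p vol) where
  carrier := {z | ∃ u : ℝ → ℂ, z.1 =ᵐ[vol] u ∧ IsDirichletPair q u z.2}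
  zero_mem' := by
    refine ⟨fun _ => 0, Lp.coeFn_zero ℂ p vol, fun _ => 0, fun _ => 0, ?_, ?_, ?_, ?_, rfl, ?_⟩
    · intro R _
      exact (contDiff_const.contDiffOn (n := 1)).absolutelyContinuousOnInterval
    · intro R _
      exact (contDiff_const.contDiffOn (n := 1)).absolutelyContinuousOnInterval
    · intro x _
      exact hasDerivWithinAt_const x _ 0
    · exact Filter.Eventually.of_forall fun x => hasDerivAt_const x 0
    · filter_upwards [Lp.coeFn_zero ℂ p vol] with x hx
      simpa using hx
  add_mem' := by
    rintro z z' ⟨u, hu, v, w, h1, h2, h3, h4, h5, h6⟩ ⟨u', hu', v', w', h1', h2', h3', h4', h5', h6'⟩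
    refine ⟨u + u', ?_, v + v', w + w', fun R hR => (h1 R hR).add (h1' R hR),
      fun R hR => (h2 R hR).add (h2' R hR), fun x hx => (h3 x hx).add (h3' x hx), ?_, ?_, ?_⟩
    · filter_upwards [Lp.coeFn_add z.1 z'.1, hu, hu'] with x hx hy hz
      simp only [Prod.fst_add, hx, Pi.add_apply, hy, hz]
    · filter_upwards [h4, h4'] with x hx hy using hx.add hy
    · simp [h5, h5']
    · filter_upwards [Lp.coeFn_add z.2 z'.2, h6, h6'] with x hx hy hz
      simp only [Prod.snd_add, hx, Pi.add_apply, hy, hz]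
      ring
  smul_mem' := by
    rintro c z ⟨u, hu, v, w, h1, h2, h3, h4, h5, h6⟩
    refine ⟨fun x => c • u x, ?_, fun x => c • v x, fun x => c • w x,
      fun R hR => (h1 R hR).const_smul c,
      fun R hR => (h2 R hR).const_smul c, fun x hx => (h3 x hx).const_smul c, ?_, ?_, ?_⟩
    · filter_upwards [Lp.coeFn_smul c z.1, hu] with x hx hy
      simp only [Prod.smul_fst, hx, Pi.smul_apply, hy]
    · filter_upwards [h4] with x hx using hx.const_smul c
    · simp [h5]
    · filter_upwards [Lp.coeFn_smul c z.2, h6] with x hx hy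
      simp only [Prod.smul_snd, hx, Pi.smul_apply, hy, smul_eq_mul]
      ring

/-- The Schrödinger operator `H = - d²/dx² + q` in `L_p(0, ∞)` with the Dirichlet condition
`u(0) = 0`: its domain consists of all `u ∈ L_p` such that `u`, `u'` are absolutely continuous on
every `[0, R]`, `u(0) = 0` and `- u'' + q u ∈ L_p`. -/
noncomputable def schrodinger (p : ℝ≥0∞) (q : ℝ → ℂ) : Lp ℂ p vol →ₗ.[ℂ] Lp ℂ p vol :=
  (dirichletGraph p q).toLinearPMap

/-- The graph is single-valued, so that `schrodinger` is the operator with this graph. -/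
theorem schrodinger_graph (p : ℝ≥0∞) (q : ℝ → ℂ) :
    (schrodinger p q).graph = dirichletGraph p q := by
  refine Submodule.toLinearPMap_graph_eq _ ?_
  rintro ⟨f, g⟩ ⟨u, hu, v, w, h1, h2, h3, h4, h5, h6⟩ hf
  simp only at hf hu h6 ⊢
  have hu0 : u =ᵐ[vol] fun _ => (0 : ℂ) := by
    rw [hf] at hu
    filter_upwards [hu, Lp.coeFn_zero ℂ p vol] with x hx hy
    rw [← hx, hy]
    rfl
  have hd : ∀ x ∈ Ioi (0 : ℝ), HasDerivAt u (v x) x := fun x hx =>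
    (h3 x (mem_Ici.2 (le_of_lt (mem_Ioi.1 hx)))).hasDerivAt (Ici_mem_nhds hx)
  have hu1 : EqOn u (fun _ => (0 : ℂ)) (Ioi 0) :=
    Measure.eqOn_of_ae_eq hu0 (fun x hx => (hd x hx).continuousAt.continuousWithinAt)
      continuousOn_const (by rw [isOpen_Ioi.interior_eq]; exact subset_closure)
  have hv : ∀ x ∈ Ioi (0 : ℝ), v x = 0 := fun x hx =>
    (hd x hx).unique ((hasDerivAt_const x (0 : ℂ)).congr_of_eventuallyEq
      (Filter.eventuallyEq_of_mem (Ioi_mem_nhds hx) hu1))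
  rw [Lp.eq_zero_iff_ae_eq_zero]
  filter_upwards [h4, h6, ae_restrict_mem measurableSet_Ioi] with x hw hg hx
  have : w x = 0 := hw.unique ((hasDerivAt_const x (0 : ℂ)).congr_of_eventuallyEq
    (Filter.eventuallyEq_of_mem (Ioi_mem_nhds hx) hv))
  rw [hg, this, hu1 hx]
  simp

/-- `z` is an eigenvalue of the (unbounded) operator `T`. -/
def IsEigenvalue {E : Type*} [AddCommGroup E] [Module ℂ E] (T : E →ₗ.[ℂ] E) (z : ℂ) : Prop :=
  ∃ f : T.domain, (f : E) ≠ 0 ∧ T f = z • (f : E)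

end HalfLine

/-! ### Weak Lebesgue spaces: integrals over sets of finite measure -/

namespace HalfLine

/-! Write the eigenvalue as `κ ^ 2` with `0 < κ.im` and put `c = I * κ`, `γ = 1 - 1/r - 1/s = 1/α`.
The equation `u'' = (q - κ²) u` factors: the derivative of `exp (-c x) * (u' + c u)` is `exp (-c x)
* q u`, and likewise with `-c`. Integrating the first from `0` and the second from infinity, then
subtracting, isolates `2 c u` and gives `‖κ‖ * |u x| ≤ sup |u| * sup_x ∫ exp (-κ.im * |x - y|) * |q
y| dy`. Taking the supremum over `x` and cancelling `sup |u|` bounds `‖κ‖` by the last factor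
(`norm_le_of_solution`). This is a Birman–Schwinger type argument in the sup norm, with no operator
theory.

Two inputs are needed. First, Hölder's inequality in weak spaces gives `∫_E |q| ≤ C ‖a‖ ‖b‖ |E| ^ γ`
(`exists_setLIntegral_mul_le`); on shells of width `1 / κ.im` this bounds the exponential integral
by a multiple of `‖a‖ ‖b‖ κ.im ^ (-γ)`. Second, `sup |u|` must be finite, although `u` is only known
to lie in `L_p`; uniform local integrability of `q` suffices (`exists_bound_of_memLp`).

Hence `‖κ‖ * κ.im ^ γ ≤ C ‖a‖ ‖b‖`. Raising this to the power `2α`, with `κ.im = |z|^(1/2) sin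
(θ/2)`, is the claim. -/

theorem distrib_le_of_wnorm_le {r : ℝ≥0∞} (hr : 0 < r) (hr' : r ≠ ∞) {f : ℝ → ℂ} {N t : ℝ}
    (hN : 0 < N) (ht : 0 < t) (hf : wnorm r f ≤ ENNReal.ofReal N) :
    distrib f t ≤ ENNReal.ofReal (N ^ r.toReal * t ^ (-r.toReal)) := by
  have hR : 0 < r.toReal := ENNReal.toReal_pos hr.ne' hr'
  rw [wnorm, if_neg hr'] at hf
  have h1 := (le_iSup₂ (f := fun (t : ℝ) (_ : 0 < t) =>
    (ENNReal.ofReal t ^ r.toReal * distrib f t) ^ (1 / r.toReal)) t ht).trans hf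
  rw [one_div, ENNReal.rpow_inv_le_iff hR, ENNReal.ofReal_rpow_of_pos ht,
    ENNReal.ofReal_rpow_of_pos hN] at h1
  have htr : 0 < t ^ r.toReal := Real.rpow_pos_of_pos ht _
  rw [Real.rpow_neg ht.le, ← div_eq_mul_inv, ENNReal.ofReal_div_of_pos htr,
    ENNReal.le_div_iff_mul_le (Or.inl (by simpa using htr)) (Or.inl ENNReal.ofReal_ne_top), mul_comm]
  exact h1

/-- The `ρ`-th power of a function in weak `L_r` with `ρ < r` is integrable over sets of finite
measure. -/
theorem exists_setLIntegral_rpow_le {r : ℝ≥0∞} (hr : 0 < r) {ρ : ℝ} (hρ : 0 < ρ)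
    (hρr : ρ * (r⁻¹).toReal < 1) :
    ∃ C : ℝ, 0 < C ∧ ∀ (f : ℝ → ℂ) (N L : ℝ) (E : Set ℝ), AEMeasurable f vol → 0 < N → 0 < L →
      wnorm r f ≤ ENNReal.ofReal N → vol E ≤ ENNReal.ofReal L →
        ∫⁻ x in E, ‖f x‖ₑ ^ ρ ∂vol ≤
          ENNReal.ofReal (C * N ^ ρ * L ^ (1 - ρ * (r⁻¹).toReal)) := by
  by_cases hr' : r = ∞
  · refine ⟨1, one_pos, fun f N L E _ hN hL hf hE => ?_⟩
    rw [wnorm, if_pos hr', eLpNorm_exponent_top] at hf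
    have h1 : ∀ᵐ x ∂vol.restrict E, ‖f x‖ₑ ^ ρ ≤ ENNReal.ofReal (N ^ ρ) := by
      refine ae_restrict_of_ae ?_
      filter_upwards [ae_le_eLpNormEssSup (f := f) (μ := vol)] with x hx
      rw [← ENNReal.ofReal_rpow_of_pos hN]
      gcongr
      exact hx.trans hf
    calc _ ≤ ∫⁻ x in E, ENNReal.ofReal (N ^ ρ) ∂vol := lintegral_mono_ae h1
      _ = ENNReal.ofReal (N ^ ρ) * vol E := setLIntegral_const _ _
      _ ≤ ENNReal.ofReal (N ^ ρ) * ENNReal.ofReal L := by gcongr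
      _ = _ := by
        rw [← ENNReal.ofReal_mul (by positivity)]
        simp [hr']
  · have hR : 0 < r.toReal := ENNReal.toReal_pos hr.ne' hr'
    rw [ENNReal.toReal_inv] at *
    set R := r.toReal with hRdef
    have hρR : ρ < R := by
      rwa [← div_eq_mul_inv, div_lt_one hR] at hρr
    have hRρ : 0 < R - ρ := sub_pos.2 hρR
    refine ⟨1 + ρ / (R - ρ), by positivity, fun f N L E hfm hN hL hf hE => ?_⟩
    -- The level at which the two bounds for the distribution function, `L` and `N ^ R * t ^ (-R)`,
    -- coincide. The layer-cake integral is split there.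
    set T : ℝ := N * L ^ (-R⁻¹) with hT
    have hTpos : 0 < T := by positivity
    have hm : ∀ t : ℝ, (vol.restrict E) {x | t < ‖f x‖} ≤ ENNReal.ofReal L := fun t =>
      (measure_mono (subset_univ _)).trans (by rwa [Measure.restrict_apply_univ])
    have hd : ∀ t : ℝ, 0 < t → (vol.restrict E) {x | t < ‖f x‖} ≤
        ENNReal.ofReal (N ^ R * t ^ (-R)) := fun t ht =>
      (Measure.restrict_le_self _).trans (distrib_le_of_wnorm_le hr hr' hN ht hf)
    have h0 : ∫⁻ x in E, ‖f x‖ₑ ^ ρ ∂vol = ENNReal.ofReal ρ *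
        ∫⁻ t in Ioi 0, (vol.restrict E) {x | t < ‖f x‖} * ENNReal.ofReal (t ^ (ρ - 1)) := by
      rw [← lintegral_rpow_eq_lintegral_meas_lt_mul (vol.restrict E)
        (Filter.Eventually.of_forall fun x => norm_nonneg (f x)) hfm.restrict.norm hρ]
      refine lintegral_congr fun x => ?_
      rw [← ofReal_norm, ENNReal.ofReal_rpow_of_nonneg (norm_nonneg _) hρ.le]
    have h1 : ∫⁻ t in Ioc 0 T, (vol.restrict E) {x | t < ‖f x‖} * ENNReal.ofReal (t ^ (ρ - 1)) ≤
        ENNReal.ofReal (L * (T ^ ρ / ρ)) := by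
      have hi : IntervalIntegrable (fun t : ℝ => t ^ (ρ - 1)) volume 0 T :=
        intervalIntegral.intervalIntegrable_rpow' (by linarith)
      calc _ ≤ ∫⁻ t in Ioc 0 T, ENNReal.ofReal L * ENNReal.ofReal (t ^ (ρ - 1)) := by
            gcongr with t
            exact hm t
        _ = ENNReal.ofReal L * ∫⁻ t in Ioc 0 T, ENNReal.ofReal (t ^ (ρ - 1)) :=
            lintegral_const_mul' _ _ ENNReal.ofReal_ne_top
        _ = ENNReal.ofReal L * ENNReal.ofReal (T ^ ρ / ρ) := by
            rw [← ofReal_integral_eq_lintegral_ofReal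
              ((intervalIntegrable_iff_integrableOn_Ioc_of_le hTpos.le).1 hi)
              ((ae_restrict_iff' measurableSet_Ioc).2 (Filter.Eventually.of_forall
                fun t ht => Real.rpow_nonneg ht.1.le _)),
              ← intervalIntegral.integral_of_le hTpos.le, integral_rpow (Or.inl (by linarith))]
            simp [hρ.ne']
        _ = _ := (ENNReal.ofReal_mul hL.le).symm
    have h2 : ∫⁻ t in Ioi T, (vol.restrict E) {x | t < ‖f x‖} * ENNReal.ofReal (t ^ (ρ - 1)) ≤
        ENNReal.ofReal (N ^ R * (T ^ (ρ - R) / (R - ρ))) := by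
      have hexp : -R + (ρ - 1) < -1 := by linarith
      calc _ ≤ ∫⁻ t in Ioi T, ENNReal.ofReal (N ^ R) * ENNReal.ofReal (t ^ (-R + (ρ - 1))) := by
            refine setLIntegral_mono' measurableSet_Ioi fun t ht => ?_
            have ht0 : 0 < t := hTpos.trans ht
            refine (mul_le_mul_left (hd t ht0) _).trans_eq ?_
            rw [← ENNReal.ofReal_mul (by positivity), ← ENNReal.ofReal_mul (by positivity),
              Real.rpow_add ht0, mul_assoc]
        _ = ENNReal.ofReal (N ^ R) * ∫⁻ t in Ioi T, ENNReal.ofReal (t ^ (-R + (ρ - 1))) :=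
            lintegral_const_mul' _ _ ENNReal.ofReal_ne_top
        _ = ENNReal.ofReal (N ^ R) * ENNReal.ofReal (T ^ (ρ - R) / (R - ρ)) := by
            rw [← ofReal_integral_eq_lintegral_ofReal (integrableOn_Ioi_rpow_of_lt hexp hTpos)
              ((ae_restrict_iff' measurableSet_Ioi).2 (Filter.Eventually.of_forall
                fun t ht => Real.rpow_nonneg (hTpos.trans ht).le _)),
              integral_Ioi_rpow_of_lt hexp hTpos]
            rw [show -R + (ρ - 1) + 1 = ρ - R by ring, neg_div, ← div_neg, neg_sub]
        _ = _ := (ENNReal.ofReal_mul (by positivity)).symm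
    rw [h0, ← Ioc_union_Ioi_eq_Ioi hTpos.le]
    refine (mul_le_mul_right ((lintegral_union_le _ _ _).trans (add_le_add h1 h2)) _).trans ?_
    rw [← ENNReal.ofReal_add (by positivity) (by positivity), ← ENNReal.ofReal_mul hρ.le]
    refine ENNReal.ofReal_le_ofReal (le_of_eq ?_)
    have e1 : T ^ ρ = N ^ ρ * L ^ (-(ρ * R⁻¹)) := by
      rw [hT, Real.mul_rpow hN.le (by positivity), ← Real.rpow_mul hL.le]
      congr 2; ring
    have e2 : T ^ (ρ - R) = N ^ ρ * N ^ (-R) * L ^ (1 - ρ * R⁻¹) := by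
      rw [hT, Real.mul_rpow hN.le (by positivity), ← Real.rpow_mul hL.le, sub_eq_add_neg,
        Real.rpow_add hN]
      congr 2
      field_simp
      ring
    have e3 : L ^ (1 - ρ * R⁻¹) = L * L ^ (-(ρ * R⁻¹)) := by
      rw [sub_eq_add_neg, Real.rpow_add hL, Real.rpow_one]
    have e4 : N ^ R * N ^ (-R) = 1 := by rw [← Real.rpow_add hN]; simp
    have e5 : ρ * (L * (T ^ ρ / ρ) + N ^ R * (T ^ (ρ - R) / (R - ρ)))
        = L * T ^ ρ + ρ / (R - ρ) * (N ^ R * T ^ (ρ - R)) := by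
      field_simp
    rw [e5, e1, e2, e3]
    linear_combination (ρ / (R - ρ)) * (N ^ ρ * (L * L ^ (-(ρ * R⁻¹)))) * e4

/-- Local integrability, with a power of the measure, of the product of two functions in weak
Lebesgue spaces. -/
theorem exists_setLIntegral_mul_le {r s : ℝ≥0∞} (hr : 0 < r) (hs : 0 < s)
    (hrs : (r⁻¹).toReal + (s⁻¹).toReal < 1) :
    ∃ C : ℝ, 0 < C ∧ ∀ (a b : ℝ → ℂ) (M N L : ℝ) (E : Set ℝ), AEMeasurable a vol →
      AEMeasurable b vol → 0 < M → 0 < N → 0 < L →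
      wnorm r a ≤ ENNReal.ofReal M → wnorm s b ≤ ENNReal.ofReal N → vol E ≤ ENNReal.ofReal L →
        ∫⁻ x in E, ‖a x * b x‖ₑ ∂vol ≤
          ENNReal.ofReal (C * (M * N) * L ^ (1 - (r⁻¹).toReal - (s⁻¹).toReal)) := by
  set A := (r⁻¹).toReal with hA
  set B := (s⁻¹).toReal with hB
  have hA0 : 0 ≤ A := ENNReal.toReal_nonneg
  have hB0 : 0 ≤ B := ENNReal.toReal_nonneg
  set γ := 1 - A - B with hγ
  have hγ0 : 0 < γ := by linarith
  -- The slack `γ` is shared equally: `A + γ / 2` and `B + γ / 2` sum to `1`, so their reciprocals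
  -- are conjugate, and each exceeds `1/r`, resp. `1/s`, so both Hölder exponents are subcritical.
  have hx : 0 < A + γ / 2 := by linarith
  have hy : 0 < B + γ / 2 := by linarith
  obtain ⟨C₁, hC₁, H₁⟩ := exists_setLIntegral_rpow_le hr (inv_pos.2 hx)
    (by rw [inv_mul_lt_iff₀ hx]; linarith)
  obtain ⟨C₂, hC₂, H₂⟩ := exists_setLIntegral_rpow_le hs (inv_pos.2 hy)
    (by rw [inv_mul_lt_iff₀ hy]; linarith)
  refine ⟨C₁ ^ (A + γ / 2) * C₂ ^ (B + γ / 2), by positivity,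
    fun a b M N L E ha hb hM hN hL hMa hNb hE => ?_⟩
  have hconj : (A + γ / 2)⁻¹.HolderConjugate (B + γ / 2)⁻¹ := by
    rw [Real.holderConjugate_iff]
    refine ⟨(one_lt_inv₀ hx).2 (by linarith), ?_⟩
    rw [inv_inv, inv_inv]
    linarith
  have h := ENNReal.lintegral_mul_le_Lp_mul_Lq (vol.restrict E) hconj
    ha.restrict.enorm hb.restrict.enorm
  simp only [Pi.mul_apply, ← enorm_mul, one_div, inv_inv] at h
  refine h.trans ((mul_le_mul' (ENNReal.rpow_le_rpow (H₁ a M L E ha hM hL hMa hE) hx.le)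
    (ENNReal.rpow_le_rpow (H₂ b N L E hb hN hL hNb hE) hy.le)).trans (le_of_eq ?_))
  rw [ENNReal.ofReal_rpow_of_pos (by positivity), ENNReal.ofReal_rpow_of_pos (by positivity),
    ← ENNReal.ofReal_mul (by positivity)]
  congr 1
  rw [Real.mul_rpow (by positivity) (by positivity), Real.mul_rpow (by positivity) (by positivity),
    Real.mul_rpow (by positivity) (by positivity), Real.mul_rpow (by positivity) (by positivity),
    ← Real.rpow_mul hM.le, ← Real.rpow_mul hN.le, ← Real.rpow_mul hL.le, ← Real.rpow_mul hL.le,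
    inv_mul_cancel₀ hx.ne', inv_mul_cancel₀ hy.ne', Real.rpow_one, Real.rpow_one, ← hA, ← hB]
  have e1 : (1 - (A + γ / 2)⁻¹ * A) * (A + γ / 2) = γ / 2 := by
    field_simp; ring
  have e2 : (1 - (B + γ / 2)⁻¹ * B) * (B + γ / 2) = γ / 2 := by
    field_simp; ring
  have e3 : L ^ γ = L ^ (γ / 2) * L ^ (γ / 2) := by
    rw [← Real.rpow_add hL]; congr 1; ring
  rw [e1, e2, e3]
  ring

/-! ### The exponential kernel -/

theorem vol_le_volume (E : Set ℝ) : vol E ≤ volume E := Measure.restrict_le_self E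

/-- The points at distance between `n / δ` and `(n + 1) / δ` from `x`. -/
theorem volume_shell_le {δ : ℝ} (hδ : 0 < δ) (x : ℝ) (n : ℕ) :
    volume {y : ℝ | ⌊δ * |x - y|⌋₊ = n} ≤ ENNReal.ofReal (2 / δ) := by
  have hsub : {y : ℝ | ⌊δ * |x - y|⌋₊ = n} ⊆
      Icc (x + n / δ) (x + (n + 1) / δ) ∪ Icc (x - (n + 1) / δ) (x - n / δ) := by
    intro y hy
    rw [mem_ofPred_eq, Nat.floor_eq_iff (by positivity)] at hy
    have h1 : n / δ ≤ |x - y| := by rw [div_le_iff₀' hδ]; exact hy.1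
    have h2 : |x - y| < (n + 1) / δ := by rw [lt_div_iff₀' hδ]; exact hy.2
    rcases abs_cases (x - y) with h | h
    · right; constructor <;> linarith
    · left; constructor <;> linarith
  refine (measure_mono hsub).trans ((measure_union_le _ _).trans ?_)
  rw [Real.volume_Icc, Real.volume_Icc, ← ENNReal.ofReal_add]
  · refine ENNReal.ofReal_le_ofReal (le_of_eq ?_)
    field_simp
    ring
  · have : (n : ℝ) / δ ≤ (n + 1) / δ := by gcongr; linarith
    linarith
  · have : (n : ℝ) / δ ≤ (n + 1) / δ := by gcongr; linarith
    linarith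

/-- Integration against `exp (- δ |x - ·|)` of a function whose integral over each set is
controlled by a power of the measure. -/
theorem lintegral_exp_mul_le {q : ℝ → ℂ} {K γ δ : ℝ} (hδ : 0 < δ)
    (hq : ∀ (L : ℝ) (E : Set ℝ), 0 < L → vol E ≤ ENNReal.ofReal L →
      ∫⁻ x in E, ‖q x‖ₑ ∂vol ≤ ENNReal.ofReal (K * L ^ γ)) (x : ℝ) :
    ∫⁻ y, ENNReal.ofReal (Real.exp (-(δ * |x - y|))) * ‖q y‖ₑ ∂vol ≤
      ENNReal.ofReal ((1 - Real.exp (-1))⁻¹ * (K * (2 / δ) ^ γ)) := by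
  have he : Real.exp (-1) < 1 := by rw [Real.exp_lt_one_iff]; norm_num
  have hmeas : Measurable fun y : ℝ => ⌊δ * |x - y|⌋₊ := by fun_prop
  have hU : (⋃ n : ℕ, {y : ℝ | ⌊δ * |x - y|⌋₊ = n}) = univ :=
    eq_univ_of_forall fun y => mem_iUnion.2 ⟨_, rfl⟩
  -- On the `n`-th shell the kernel is at most `exp (-n)`, while the measure is at most `2 / δ` for
  -- every `n`; the sum over shells is geometric.
  have hterm : ∀ n : ℕ, ∫⁻ y in {y : ℝ | ⌊δ * |x - y|⌋₊ = n},
      ENNReal.ofReal (Real.exp (-(δ * |x - y|))) * ‖q y‖ₑ ∂vol ≤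
        ENNReal.ofReal (Real.exp (-1) ^ n) * ENNReal.ofReal (K * (2 / δ) ^ γ) := by
    intro n
    calc _ ≤ ∫⁻ y in {y : ℝ | ⌊δ * |x - y|⌋₊ = n},
          ENNReal.ofReal (Real.exp (-1) ^ n) * ‖q y‖ₑ ∂vol := by
          refine setLIntegral_mono' (hmeas (measurableSet_singleton n)) fun y hy => ?_
          gcongr
          rw [← Real.exp_nat_mul, Real.exp_le_exp]
          rw [mem_ofPred_eq, Nat.floor_eq_iff (by positivity)] at hy
          linarith [hy.1]
      _ = ENNReal.ofReal (Real.exp (-1) ^ n) *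
          ∫⁻ y in {y : ℝ | ⌊δ * |x - y|⌋₊ = n}, ‖q y‖ₑ ∂vol :=
          lintegral_const_mul' _ _ ENNReal.ofReal_ne_top
      _ ≤ _ := by
          gcongr
          exact hq _ _ (by positivity) ((vol_le_volume _).trans (volume_shell_le hδ x n))
  have hsum : ∑' n : ℕ, ENNReal.ofReal (Real.exp (-1) ^ n) =
      ENNReal.ofReal ((1 - Real.exp (-1))⁻¹) := by
    rw [← ENNReal.ofReal_tsum_of_nonneg (fun n => by positivity)
      (summable_geometric_of_lt_one (Real.exp_pos _).le he),
      tsum_geometric_of_lt_one (Real.exp_pos _).le he]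
  calc _ = ∫⁻ y in ⋃ n : ℕ, {y : ℝ | ⌊δ * |x - y|⌋₊ = n},
        ENNReal.ofReal (Real.exp (-(δ * |x - y|))) * ‖q y‖ₑ ∂vol := by
        rw [hU, Measure.restrict_univ]
    _ ≤ _ := lintegral_iUnion_le _ _
    _ ≤ ∑' n : ℕ, ENNReal.ofReal (Real.exp (-1) ^ n) * ENNReal.ofReal (K * (2 / δ) ^ γ) :=
        ENNReal.tsum_le_tsum hterm
    _ = _ := by
        rw [ENNReal.tsum_mul_right, hsum, ← ENNReal.ofReal_mul (by
          rw [inv_nonneg]; linarith)]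

end HalfLine

/-! ### Increments of absolutely continuous functions -/

theorem AbsolutelyContinuousOnInterval.clm_comp {E F : Type*} [NormedAddCommGroup E]
    [NormedSpace ℝ E] [NormedAddCommGroup F] [NormedSpace ℝ F] (T : E →L[ℝ] F) {f : ℝ → E}
    {a b : ℝ} (hf : AbsolutelyContinuousOnInterval f a b) :
    AbsolutelyContinuousOnInterval (fun x => T (f x)) a b := by
  apply squeeze_zero (fun t => ?_) (fun t => ?_) 
    (by simpa using Filter.Tendsto.const_mul ‖T‖ hf)
  · exact Finset.sum_nonneg fun i _ => dist_nonneg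
  · rw [Finset.mul_sum]
    exact Finset.sum_le_sum fun i _ => T.lipschitz.dist_le_mul _ _

/-- The increment of an absolutely continuous function is at most the integral of the norm of its
derivative. -/
theorem AbsolutelyContinuousOnInterval.norm_sub_le {E : Type*} [NormedAddCommGroup E]
    [InnerProductSpace ℝ E] {f g : ℝ → E} {a b B : ℝ} (hab : a ≤ b)
    (hf : AbsolutelyContinuousOnInterval f a b)
    (hg : ∀ᵐ t ∂volume.restrict (Ioc a b), HasDerivAt f (g t) t)
    (hB : 0 ≤ B) (h : ∫⁻ t in Ioc a b, ‖g t‖ₑ ≤ ENNReal.ofReal B) :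
    ‖f b - f a‖ ≤ B := by
  -- Pairing with the increment itself reduces to a real-valued function: `‖D‖ ^ 2` is the integral
  -- of the derivative of `⟪D, f⟫`, hence at most `‖D‖ * B`.
  set D := f b - f a with hD
  have hint := (hf.clm_comp (innerSL ℝ D)).integral_deriv_eq_sub
  rw [← map_sub, innerSL_apply_apply, ← hD, real_inner_self_eq_norm_sq,
    intervalIntegral.integral_of_le hab] at hint
  have h1 : ‖D‖ ^ 2 ≤ ‖D‖ * B := by
    rw [← hint]
    refine (Real.le_norm_self _).trans ((norm_integral_le_lintegral_norm _).trans ?_)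
    refine ENNReal.toReal_le_of_le_ofReal (by positivity) ?_
    calc _ ≤ ∫⁻ t in Ioc a b, ‖D‖ₑ * ‖g t‖ₑ := by
          refine lintegral_mono_ae ?_
          filter_upwards [hg] with t ht
          have hd : HasDerivAt (fun x => innerSL ℝ D (f x)) (innerSL ℝ D (g t)) t :=
            (innerSL ℝ D).hasFDerivAt.comp_hasDerivAt t ht
          rw [hd.deriv, ← ofReal_norm, ← ofReal_norm, ← ENNReal.ofReal_mul (norm_nonneg _)]
          exact ENNReal.ofReal_le_ofReal (norm_inner_le_norm _ _)
      _ = ‖D‖ₑ * ∫⁻ t in Ioc a b, ‖g t‖ₑ := lintegral_const_mul' _ _ enorm_ne_top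
      _ ≤ ENNReal.ofReal (‖D‖ * B) := by
          rw [ENNReal.ofReal_mul (norm_nonneg _), ofReal_norm]
          gcongr
  rcases (norm_nonneg D).eq_or_lt with h0 | h0
  · rwa [← h0]
  · rw [sq] at h1
    exact le_of_mul_le_mul_left h1 h0

/-! ### Boundedness of solutions in `L_p` -/

namespace HalfLine

theorem restrict_vol_Ioc {x y : ℝ} (hx : 0 ≤ x) :
    vol.restrict (Ioc x y) = volume.restrict (Ioc x y) := by
  have hsub : Ioc x y ⊆ Ioi 0 := fun t ht => hx.trans_lt ht.1
  rw [vol, Measure.restrict_restrict measurableSet_Ioc, inter_eq_left.2 hsub]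

/-- A function in `L_p` takes values below a fixed bound on all intervals of a given length. -/
theorem exists_norm_lt_of_memLp {p : ℝ≥0∞} (hp : 1 ≤ p) (hp' : p ≠ ∞) {u : ℝ → ℂ}
    (hu : MemLp u p vol) {l : ℝ} (hl : 0 < l) (hl1 : l ≤ 1) :
    ∃ m : ℝ, 0 < m ∧ ∀ c : ℝ, 0 ≤ c → ∃ y ∈ Ioc c (c + l), ‖u y‖ < m := by
  have hp0 : p ≠ 0 := (zero_lt_one.trans_le hp).ne'
  have hp1 : 1 ≤ p.toReal := by
    rw [← ENNReal.toReal_one]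
    exact ENNReal.toReal_mono hp' hp
  set N := (eLpNorm u p vol).toReal with hN
  have hN0 : 0 ≤ N := ENNReal.toReal_nonneg
  have hm : 0 < (N + 1) / l := by positivity
  -- If `‖u‖` were at least this on a whole interval of length `l`, Chebyshev would give `l ≤ (N /
  -- (N + 1) * l) ^ p`. The right side is below `l`, since the base is at most `1` and `1 ≤ p`; the
  -- `+ 1` makes this strict.
  refine ⟨(N + 1) / l, hm, fun c hc => ?_⟩
  by_contra! hcon
  have h1 := meas_ge_le_mul_pow_eLpNorm_enorm vol hp0 hp' hu.1
    (ε := ENNReal.ofReal ((N + 1) / l)) (by simpa using hm)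
    (fun h => absurd h ENNReal.ofReal_ne_top)
  have h2 : ENNReal.ofReal l ≤ vol {x | ENNReal.ofReal ((N + 1) / l) ≤ ‖u x‖ₑ} := by
    calc ENNReal.ofReal l = vol (Ioc c (c + l)) := by
          rw [← Measure.restrict_apply_univ, restrict_vol_Ioc hc]
          simp
      _ ≤ _ := measure_mono fun y hy => by
          rw [mem_ofPred_eq, ← ofReal_norm]
          exact ENNReal.ofReal_le_ofReal (hcon y hy)
  have h3 := h2.trans h1
  rw [← ENNReal.mul_rpow_of_nonneg _ _ (by linarith), ← ENNReal.ofReal_inv_of_pos hm,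
    ← ENNReal.ofReal_toReal hu.2.ne, ← ENNReal.ofReal_mul (by positivity),
    ENNReal.ofReal_rpow_of_nonneg (by positivity) (by linarith),
    ENNReal.ofReal_le_ofReal_iff (by positivity), ← hN] at h3
  have h4 : ((N + 1) / l)⁻¹ * N = N / (N + 1) * l := by
    field_simp
  have h5 : N / (N + 1) < 1 := by rw [div_lt_one (by linarith)]; linarith
  have h6 : N / (N + 1) * l < l := mul_lt_of_lt_one_left hl h5
  have h7 : (N / (N + 1) * l) ^ p.toReal ≤ (N / (N + 1) * l) ^ (1 : ℝ) :=
    Real.rpow_le_rpow_of_exponent_ge_of_imp (by positivity) (by linarith) hp1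
      (fun _ h => by linarith)
  rw [h4] at h3
  rw [Real.rpow_one] at h7
  linarith

/-- A solution in `L_p` of `u'' = (q - z) u`, with `q` uniformly locally integrable, is bounded
together with its derivative. -/
theorem exists_bound_of_memLp {p : ℝ≥0∞} (hp : 1 ≤ p) (hp' : p ≠ ∞) {u v q : ℝ → ℂ} {z : ℂ}
    {K : ℝ} (hK : 0 ≤ K) (hLp : MemLp u p vol)
    (hv : ∀ R : ℝ, 0 < R → AbsolutelyContinuousOnInterval v 0 R)
    (hu : ∀ x ∈ Ici (0 : ℝ), HasDerivWithinAt u (v x) (Ici 0) x)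
    (hw : ∀ᵐ x ∂vol, HasDerivAt v (q x * u x - z * u x) x)
    (hq : ∀ c : ℝ, 0 ≤ c → ∫⁻ x in Ioc c (c + 1), ‖q x‖ₑ ≤ ENNReal.ofReal K) :
    ∃ M : ℝ, ∀ x : ℝ, 0 ≤ x → ‖u x‖ ≤ M ∧ ‖v x‖ ≤ M := by
  set A := K + ‖z‖ with hA
  have hA0 : 0 ≤ A := by positivity
  -- With `A * h ≤ 1 / 6`, the bounds below give `S ≤ m + 6 m + 3 S A h ≤ 7 m + S / 2` for the
  -- maximum `S` of `‖u‖` on `[c, c + h]`, hence `14 * m`.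
  set h : ℝ := 1 / (1 + 6 * A) with hh
  have hpos : 0 < h := by positivity
  have hh1 : h ≤ 1 := by rw [hh, div_le_one (by positivity)]; linarith
  have hAh : A * h ≤ 1 / 6 := by
    rw [hh, mul_one_div, div_le_iff₀ (by positivity)]
    linarith
  obtain ⟨m, hm, hmu⟩ := exists_norm_lt_of_memLp hp hp' hLp (l := h / 3) (by positivity)
    (by linarith)
  have key : ∀ c : ℝ, 0 ≤ c → ‖u c‖ ≤ 14 * m ∧ ‖v c‖ ≤ 3 / h * (5 * m) := by
    intro c hc
    have hI : Icc c (c + h) ⊆ Ici 0 := fun t ht => hc.trans ht.1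
    have hu' : ∀ x ∈ Icc c (c + h), HasDerivWithinAt u (v x) (Icc c (c + h)) x := fun x hx =>
      (hu x (hI hx)).mono hI
    obtain ⟨x₀, hx₀, hmax⟩ := (isCompact_Icc (a := c) (b := c + h)).exists_isMaxOn
      (nonempty_Icc.2 (by linarith))
      (f := fun t => ‖u t‖) (fun x hx => (hu' x hx).continuousWithinAt.norm)
    set S := ‖u x₀‖ with hS
    have hS0 : 0 ≤ S := norm_nonneg _
    -- The oscillation of `v` does not become small with `h`, as `K` controls only intervals of
    -- length one; the small factor `h` appears when `v` is integrated to recover `u`.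
    have hmono : ∀ x y : ℝ, c ≤ x → x ≤ y → y ≤ c + h → ‖v y - v x‖ ≤ S * A := by
      intro x y hx hxy hy
      rcases hxy.eq_or_lt with rfl | hxy'
      · simp only [sub_self, norm_zero]; positivity
      have hac : AbsolutelyContinuousOnInterval v x y :=
        (hv y (by linarith)).mono (by
          rw [uIcc_of_le hxy, uIcc_of_le (by linarith)]
          exact Icc_subset_Icc_left (by linarith))
      refine hac.norm_sub_le hxy (g := fun t => q t * u t - z * u t) ?_ (by positivity) ?_
      · rw [← restrict_vol_Ioc (hc.trans hx)]
        exact ae_restrict_of_ae hw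
      · calc ∫⁻ t in Ioc x y, ‖q t * u t - z * u t‖ₑ
            ≤ ∫⁻ t in Ioc x y, ENNReal.ofReal S * (‖q t‖ₑ + ENNReal.ofReal ‖z‖) := by
              refine setLIntegral_mono' measurableSet_Ioc fun t ht => ?_
              rw [← sub_mul, enorm_mul, mul_comm]
              gcongr
              · rw [← ofReal_norm]
                exact ENNReal.ofReal_le_ofReal
                  (hmax (show t ∈ Icc c (c + h) from ⟨by linarith [ht.1], by linarith [ht.2]⟩))
              · rw [ofReal_norm]
                exact enorm_sub_le
          _ = ENNReal.ofReal S * (∫⁻ t in Ioc x y, ‖q t‖ₑ + ENNReal.ofReal ‖z‖) :=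
              lintegral_const_mul' _ _ ENNReal.ofReal_ne_top
          _ = ENNReal.ofReal S * ((∫⁻ t in Ioc x y, ‖q t‖ₑ) +
                ENNReal.ofReal ‖z‖ * ENNReal.ofReal (y - x)) := by
              rw [lintegral_add_right _ measurable_const, setLIntegral_const, Real.volume_Ioc]
          _ ≤ ENNReal.ofReal S * (ENNReal.ofReal K + ENNReal.ofReal ‖z‖) := by
              gcongr
              · refine (lintegral_mono_set ?_).trans (hq c hc)
                exact Ioc_subset_Ioc hx (by linarith)
              · refine mul_le_of_le_one_right' ?_
                rw [ENNReal.ofReal_le_one]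
                linarith
          _ = ENNReal.ofReal (S * A) := by
              rw [← ENNReal.ofReal_add hK (norm_nonneg _), ← ENNReal.ofReal_mul hS0]
    have hosc : ∀ x ∈ Icc c (c + h), ∀ y ∈ Icc c (c + h), ‖v y - v x‖ ≤ S * A := by
      intro x hx y hy
      rcases le_total x y with hxy | hxy
      · exact hmono x y hx.1 hxy hy.2
      · rw [norm_sub_rev]
        exact hmono y x hy.1 hxy hx.2
    obtain ⟨y₁, hy₁, hu₁⟩ := hmu c hc
    obtain ⟨y₂, hy₂, hu₂⟩ := hmu (c + 2 * h / 3) (by positivity)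
    have hy₁I : y₁ ∈ Icc c (c + h) := ⟨hy₁.1.le, by linarith [hy₁.2]⟩
    have hy₂I : y₂ ∈ Icc c (c + h) := ⟨by linarith [hy₂.1], by linarith [hy₂.2]⟩
    have hvb : ∀ x ∈ Icc c (c + h), ‖v x‖ ≤ 3 / h * (2 * m + S * A * h) := by
      intro x hx
      -- The function `t ↦ u t - t • v x` has derivative `v t - v x`. Between the points `y₁`, `y₂`
      -- in the outer thirds, where `u` is small, this makes `v x` close to a difference quotient of
      -- size at most `2 m / (h / 3)`.
      have h1 := (convex_Icc c (c + h)).norm_image_sub_le_of_norm_hasDerivWithin_le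
        (f := fun t : ℝ => u t - t • v x) (f' := fun t => v t - (1 : ℝ) • v x) (C := S * A)
        (fun t ht => (hu' t ht).sub ((hasDerivWithinAt_id t _).smul_const (v x)))
        (fun t ht => by rw [one_smul]; exact hosc x hx t ht) hy₁I hy₂I
      have h2 : (y₂ - y₁) • v x = (u y₂ - u y₁) - ((u y₂ - y₂ • v x) - (u y₁ - y₁ • v x)) := by
        rw [sub_smul]; ring
      have hlen : h / 3 ≤ y₂ - y₁ := by linarith [hy₁.2, hy₂.1]
      have hlen' : ‖y₂ - y₁‖ ≤ h := by
        rw [Real.norm_eq_abs, abs_of_nonneg (by linarith)]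
        linarith [hy₁I.1, hy₂I.2]
      have h3 : (y₂ - y₁) * ‖v x‖ ≤ 2 * m + S * A * h := by
        have h4 : ‖(y₂ - y₁) • v x‖ = (y₂ - y₁) * ‖v x‖ := by
          rw [norm_smul, Real.norm_eq_abs, abs_of_nonneg (by linarith)]
        rw [← h4, h2]
        have h5 := mul_le_mul_of_nonneg_left hlen' (by positivity : 0 ≤ S * A)
        linarith [norm_sub_le (u y₂ - u y₁) ((u y₂ - y₂ • v x) - (u y₁ - y₁ • v x)),
          norm_sub_le (u y₂) (u y₁)]
      have h6 : h / 3 * ‖v x‖ ≤ 2 * m + S * A * h :=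
        (mul_le_mul_of_nonneg_right hlen (norm_nonneg _)).trans h3
      rw [show (3 / h : ℝ) = (h / 3)⁻¹ by rw [inv_div], le_inv_mul_iff₀ (by positivity)]
      exact h6
    have hSm : S ≤ 14 * m := by
      have h1 := (convex_Icc c (c + h)).norm_image_sub_le_of_norm_hasDerivWithin_le
        hu' hvb hy₁I hx₀
      have h2 : ‖x₀ - y₁‖ ≤ h := by
        rw [Real.norm_eq_abs, abs_le]
        constructor <;> linarith [hx₀.1, hx₀.2, hy₁I.1, hy₁I.2]
      have h3 : 3 / h * (2 * m + S * A * h) * ‖x₀ - y₁‖ ≤ 6 * m + 3 * (S * (A * h)) := by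
        refine (mul_le_mul_of_nonneg_left h2 (by positivity)).trans_eq ?_
        field_simp
        ring
      have h4 := mul_le_mul_of_nonneg_left hAh hS0
      have h5 : S ≤ ‖u x₀ - u y₁‖ + ‖u y₁‖ := by
        simpa using norm_add_le (u x₀ - u y₁) (u y₁)
      linarith
    have hcI : c ∈ Icc c (c + h) := ⟨le_rfl, by linarith⟩
    refine ⟨(hmax hcI).trans hSm, (hvb c hcI).trans ?_⟩
    have h4 := mul_le_mul_of_nonneg_left hAh hS0
    gcongr
    linarith
  refine ⟨max (14 * m) (3 / h * (5 * m)), fun x hx => ?_⟩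
  exact ⟨(key x hx).1.trans (le_max_left _ _), (key x hx).2.trans (le_max_right _ _)⟩

/-! ### Variation of constants and the Green kernel bound -/

/-- Variation of constants for the first-order factor `v + c u` of the equation
`u'' = (q + c²) u`, in terms of a bound for `u`. -/
theorem norm_exp_mul_sub_le {u v q : ℝ → ℂ} {c : ℂ} {M J x₀ x y : ℝ} (hM : 0 ≤ M) (hJ : 0 ≤ J)
    (hx : 0 ≤ x) (hxy : x ≤ y)
    (huac : ∀ R : ℝ, 0 < R → AbsolutelyContinuousOnInterval u 0 R)
    (hvac : ∀ R : ℝ, 0 < R → AbsolutelyContinuousOnInterval v 0 R)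
    (hu : ∀ x ∈ Ici (0 : ℝ), HasDerivWithinAt u (v x) (Ici 0) x)
    (hw : ∀ᵐ x ∂vol, HasDerivAt v (q x * u x + c ^ 2 * u x) x)
    (huM : ∀ x : ℝ, 0 ≤ x → ‖u x‖ ≤ M)
    (hint : ∫⁻ t in Ioc x y, ENNReal.ofReal (Real.exp (c.re * (x₀ - t))) * ‖q t‖ₑ ≤
      ENNReal.ofReal J) :
    ‖Complex.exp (-c * y) * (v y + c * u y) - Complex.exp (-c * x) * (v x + c * u x)‖ ≤
      Real.exp (-c.re * x₀) * (M * J) := by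
  rcases hxy.eq_or_lt with rfl | hlt
  · simp only [sub_self, norm_zero]; positivity
  have hy : 0 < y := hx.trans_lt hlt
  have hsub : uIcc x y ⊆ uIcc 0 y := by
    rw [uIcc_of_le hxy, uIcc_of_le hy.le]
    exact Icc_subset_Icc_left hx
  have hexp : AbsolutelyContinuousOnInterval (fun t : ℝ => Complex.exp (-c * t)) x y :=
    ContDiffOn.absolutelyContinuousOnInterval
      ((contDiff_const.mul Complex.ofRealCLM.contDiff).cexp.contDiffOn)
  have hac : AbsolutelyContinuousOnInterval
      (fun t : ℝ => Complex.exp (-c * t) * (v t + c * u t)) x y :=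
    hexp.fun_smul (((hvac y hy).mono hsub).fun_add (((huac y hy).mono hsub).const_smul c))
  refine hac.norm_sub_le hxy (g := fun t : ℝ => Complex.exp (-c * t) * (q t * u t)) ?_
    (by positivity) ?_
  · rw [← restrict_vol_Ioc hx]
    filter_upwards [ae_restrict_of_ae hw, ae_restrict_mem measurableSet_Ioc] with t ht htI
    have ht0 : 0 < t := hx.trans_lt htI.1
    have hut : HasDerivAt u (v t) t := (hu t ht0.le).hasDerivAt (Ici_mem_nhds ht0)
    have het : HasDerivAt (fun t : ℝ => Complex.exp (-c * t)) (Complex.exp (-c * t) * (-c)) t := by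
      have := ((hasDerivAt_id (t : ℂ)).const_mul (-c)).cexp.comp_ofReal
      simpa using this
    convert! het.mul (ht.add (hut.const_mul c)) using 1
    simp only [Pi.add_apply]
    ring
  · calc _ ≤ ∫⁻ t in Ioc x y, ENNReal.ofReal (Real.exp (-c.re * x₀) * M) *
          (ENNReal.ofReal (Real.exp (c.re * (x₀ - t))) * ‖q t‖ₑ) := by
          refine setLIntegral_mono' measurableSet_Ioc fun t ht => ?_
          rw [← ofReal_norm, ← ofReal_norm, ← ENNReal.ofReal_mul (by positivity),
            ← ENNReal.ofReal_mul (by positivity)]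
          refine ENNReal.ofReal_le_ofReal ?_
          -- Factoring out the value at `x₀` leaves the kernel centred at `x₀`.
          have h1 : Real.exp (-c.re * t) = Real.exp (-c.re * x₀) * Real.exp (c.re * (x₀ - t)) := by
            rw [← Real.exp_add]; congr 1; ring
          have h2 : (-c * (t : ℂ)).re = -c.re * t := by simp
          rw [norm_mul, norm_mul, Complex.norm_exp, h2, h1]
          have h3 : ‖q t‖ * ‖u t‖ ≤ ‖q t‖ * M :=
            mul_le_mul_of_nonneg_left (huM t (hx.trans ht.1.le)) (norm_nonneg _)
          refine (mul_le_mul_of_nonneg_left h3 (by positivity)).trans_eq ?_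
          ring
      _ = ENNReal.ofReal (Real.exp (-c.re * x₀) * M) *
          ∫⁻ t in Ioc x y, ENNReal.ofReal (Real.exp (c.re * (x₀ - t))) * ‖q t‖ₑ :=
          lintegral_const_mul' _ _ ENNReal.ofReal_ne_top
      _ ≤ ENNReal.ofReal (Real.exp (-c.re * x₀) * M) * ENNReal.ofReal J := by gcongr
      _ = _ := by rw [← ENNReal.ofReal_mul (by positivity), mul_assoc]

/-- A bounded Dirichlet solution of `u'' = (q - κ²) u` satisfies the bound that follows from the
Green kernel estimate `|G(x, y)| ≤ exp (- Im κ |x - y|) / |κ|`. -/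
theorem norm_mul_norm_le {u v q : ℝ → ℂ} {κ : ℂ} {M M' D : ℝ} (hκ : 0 < κ.im) (hD : 0 ≤ D)
    (huac : ∀ R : ℝ, 0 < R → AbsolutelyContinuousOnInterval u 0 R)
    (hvac : ∀ R : ℝ, 0 < R → AbsolutelyContinuousOnInterval v 0 R)
    (hu : ∀ x ∈ Ici (0 : ℝ), HasDerivWithinAt u (v x) (Ici 0) x)
    (hw : ∀ᵐ x ∂vol, HasDerivAt v (q x * u x - κ ^ 2 * u x) x) (hu0 : u 0 = 0)
    (huM : ∀ x : ℝ, 0 ≤ x → ‖u x‖ ≤ M) (hvM : ∀ x : ℝ, 0 ≤ x → ‖v x‖ ≤ M')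
    (hint : ∀ x : ℝ, 0 ≤ x →
      ∫⁻ y, ENNReal.ofReal (Real.exp (-(κ.im * |x - y|))) * ‖q y‖ₑ ∂vol ≤ ENNReal.ofReal D)
    {x : ℝ} (hx : 0 ≤ x) : ‖κ‖ * ‖u x‖ ≤ M * D := by
  have hM : 0 ≤ M := (norm_nonneg _).trans (huM 0 le_rfl)
  set c : ℂ := Complex.I * κ with hc
  have hc2 : c ^ 2 = -κ ^ 2 := by rw [hc, mul_pow, Complex.I_sq]; ring
  have hcre : c.re = -κ.im := by simp [hc]
  have hncre : (-c).re = κ.im := by simp [hc]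
  have hcn : ‖c‖ = ‖κ‖ := by simp [hc]
  have hw1 : ∀ᵐ x ∂vol, HasDerivAt v (q x * u x + c ^ 2 * u x) x := by
    filter_upwards [hw] with t ht
    rw [hc2, neg_mul, ← sub_eq_add_neg]
    exact ht
  have hw2 : ∀ᵐ x ∂vol, HasDerivAt v (q x * u x + (-c) ^ 2 * u x) x := by
    simpa only [neg_sq] using hw1
  let k : ℝ → ℝ → ℝ≥0∞ := fun x y => ENNReal.ofReal (Real.exp (-(κ.im * |x - y|))) * ‖q y‖ₑ
  have hsplit : ∀ x : ℝ, 0 ≤ x →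
      (∫⁻ y in Ioc 0 x, k x y) + ∫⁻ y in Ioi x, k x y ≤ ENNReal.ofReal D := by
    intro x hx
    rw [← lintegral_union measurableSet_Ioi (Ioc_disjoint_Ioi le_rfl), Ioc_union_Ioi_eq_Ioi hx]
    exact hint x hx
  have hfin1 : ∀ x : ℝ, 0 ≤ x → ∫⁻ y in Ioc 0 x, k x y ≠ ∞ := fun x hx =>
    ((le_self_add.trans (hsplit x hx)).trans_lt ENNReal.ofReal_lt_top).ne
  have hfin2 : ∀ x : ℝ, 0 ≤ x → ∫⁻ y in Ioi x, k x y ≠ ∞ := fun x hx =>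
    ((le_add_self.trans (hsplit x hx)).trans_lt ENNReal.ofReal_lt_top).ne
  set I₁ : ℝ → ℝ := fun x => (∫⁻ y in Ioc 0 x, k x y).toReal with hI₁
  set I₂ : ℝ → ℝ := fun x => (∫⁻ y in Ioi x, k x y).toReal with hI₂
  have hI₁0 : ∀ x, 0 ≤ I₁ x := fun x => ENNReal.toReal_nonneg
  have hI₂0 : ∀ x, 0 ≤ I₂ x := fun x => ENNReal.toReal_nonneg
  have hsum : ∀ x : ℝ, 0 ≤ x → I₁ x + I₂ x ≤ D := by
    intro x hx
    rw [hI₁, hI₂]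
    simp only
    rw [← ENNReal.toReal_add (hfin1 x hx) (hfin2 x hx)]
    exact ENNReal.toReal_le_of_le_ofReal hD (hsplit x hx)
  -- The factor `exp (c t)` decays, so integrating over `[x, T]` and letting `T → ∞` removes the
  -- boundary term at `T`; only the finiteness of `M'` matters.
  have hφ : ∀ x : ℝ, 0 ≤ x → ‖v x + -c * u x‖ ≤ M * I₂ x := by
    intro x hx
    have h1 : ∀ T : ℝ, x ≤ T → Real.exp (-κ.im * x) * ‖v x + -c * u x‖ ≤
        Real.exp (-κ.im * x) * (M * I₂ x) + Real.exp (-κ.im * T) * (M' + ‖κ‖ * M) := by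
      intro T hT
      have h2 := norm_exp_mul_sub_le (c := -c) (x₀ := x) hM (hI₂0 x) hx hT huac hvac hu hw2 huM
        (by
          rw [hI₂, ENNReal.ofReal_toReal (hfin2 x hx)]
          refine (setLIntegral_mono' measurableSet_Ioc fun t ht => ?_).trans
            (lintegral_mono_set Ioc_subset_Ioi_self)
          simp only [k]
          rw [hncre, abs_of_nonpos (by linarith [ht.1])]
          apply le_of_eq
          congr 3
          ring)
      rw [hncre] at h2
      have h3 := norm_sub_norm_le (Complex.exp (- -c * x) * (v x + -c * u x))
        (Complex.exp (- -c * T) * (v T + -c * u T))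
      rw [norm_sub_rev] at h3
      have e : ∀ t : ℝ, ‖Complex.exp (- -c * t)‖ = Real.exp (-κ.im * t) := by
        intro t
        rw [Complex.norm_exp]
        congr 1
        simp [hcre]
      rw [norm_mul, norm_mul, e, e] at h3
      have h4 : ‖v T + -c * u T‖ ≤ M' + ‖κ‖ * M := by
        refine (norm_add_le _ _).trans (add_le_add (hvM T (hx.trans hT)) ?_)
        rw [norm_mul, norm_neg, hcn]
        gcongr
        exact huM T (hx.trans hT)
      have h5 := mul_le_mul_of_nonneg_left h4 (Real.exp_pos (-κ.im * T)).le
      linarith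
    have hlim : Filter.Tendsto (fun T : ℝ => Real.exp (-κ.im * x) * (M * I₂ x) +
        Real.exp (-κ.im * T) * (M' + ‖κ‖ * M)) Filter.atTop
        (nhds (Real.exp (-κ.im * x) * (M * I₂ x) + 0 * (M' + ‖κ‖ * M))) := by
      refine tendsto_const_nhds.add (Filter.Tendsto.mul_const _ ?_)
      exact Real.tendsto_exp_atBot.comp
        (Filter.tendsto_id.const_mul_atTop_of_neg (by linarith))
    have h6 := ge_of_tendsto hlim (Filter.eventually_atTop.2 ⟨x, h1⟩)
    rw [zero_mul, add_zero] at h6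
    exact le_of_mul_le_mul_left h6 (Real.exp_pos _)
  -- This factor is integrated from `0`. The Dirichlet condition leaves `v 0` as the only boundary
  -- datum, and `hφ` at `0` then bounds it.
  have hψ : ‖v x + c * u x‖ ≤ Real.exp (-κ.im * x) * ‖v 0‖ + M * I₁ x := by
    have h2 := norm_exp_mul_sub_le (c := c) (x₀ := x) hM (hI₁0 x) le_rfl hx huac hvac hu hw1 huM
      (by
        rw [hI₁, ENNReal.ofReal_toReal (hfin1 x hx)]
        refine setLIntegral_mono' measurableSet_Ioc fun t ht => ?_
        simp only [k]
        rw [hcre, abs_of_nonneg (by linarith [ht.2])]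
        apply le_of_eq
        congr 3
        ring)
    have h3 := norm_sub_norm_le (Complex.exp (-c * x) * (v x + c * u x))
      (Complex.exp (-c * (0 : ℝ)) * (v 0 + c * u 0))
    have e : ‖Complex.exp (-c * x)‖ = Real.exp (κ.im * x) := by
      rw [Complex.norm_exp]
      congr 1
      simp [hc]
    rw [norm_mul, e] at h3
    rw [hcre, neg_neg] at h2
    have h4 : ‖Complex.exp (-c * (0 : ℝ)) * (v 0 + c * u 0)‖ = ‖v 0‖ := by simp [hu0]
    rw [h4] at h3
    have h5 : Real.exp (κ.im * x) * ‖v x + c * u x‖ ≤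
        Real.exp (κ.im * x) * (Real.exp (-κ.im * x) * ‖v 0‖ + M * I₁ x) := by
      rw [mul_add, ← mul_assoc, ← Real.exp_add]
      simp only [neg_mul, add_neg_cancel, Real.exp_zero, one_mul]
      linarith
    exact le_of_mul_le_mul_left h5 (Real.exp_pos _)
  have hv0 : ‖v 0‖ ≤ M * D := by
    have h1 := hφ 0 le_rfl
    rw [hu0, mul_zero, add_zero] at h1
    refine h1.trans (mul_le_mul_of_nonneg_left ?_ hM)
    linarith [hsum 0 le_rfl, hI₁0 0]
  have h1 : 2 * (‖κ‖ * ‖u x‖) = ‖(v x + c * u x) - (v x + -c * u x)‖ := by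
    rw [show (v x + c * u x) - (v x + -c * u x) = 2 * (c * u x) by ring, norm_mul, norm_mul, hcn]
    simp
  have h2 := norm_sub_le (v x + c * u x) (v x + -c * u x)
  have h3 : Real.exp (-κ.im * x) * ‖v 0‖ ≤ M * D := by
    refine (mul_le_of_le_one_left (norm_nonneg _) ?_).trans hv0
    rw [Real.exp_le_one_iff, neg_mul, neg_nonpos]
    positivity
  have h4 := mul_le_mul_of_nonneg_left (hsum x hx) hM
  linarith [hφ x hx]

/-- If `u` does not vanish identically, then `‖κ‖` is at most the norm of the potential. -/
theorem norm_le_of_solution {u v q : ℝ → ℂ} {κ : ℂ} {M D : ℝ} (hκ : 0 < κ.im) (hD : 0 ≤ D)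
    (huac : ∀ R : ℝ, 0 < R → AbsolutelyContinuousOnInterval u 0 R)
    (hvac : ∀ R : ℝ, 0 < R → AbsolutelyContinuousOnInterval v 0 R)
    (hu : ∀ x ∈ Ici (0 : ℝ), HasDerivWithinAt u (v x) (Ici 0) x)
    (hw : ∀ᵐ x ∂vol, HasDerivAt v (q x * u x - κ ^ 2 * u x) x) (hu0 : u 0 = 0)
    (hM : ∀ x : ℝ, 0 ≤ x → ‖u x‖ ≤ M ∧ ‖v x‖ ≤ M)
    (hint : ∀ x : ℝ, 0 ≤ x →
      ∫⁻ y, ENNReal.ofReal (Real.exp (-(κ.im * |x - y|))) * ‖q y‖ₑ ∂vol ≤ ENNReal.ofReal D)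
    {x : ℝ} (hx : 0 ≤ x) (hux : u x ≠ 0) : ‖κ‖ ≤ D := by
  have hκ0 : 0 < ‖κ‖ := norm_pos_iff.2 fun h => by simp [h] at hκ
  let S : Set ℝ := (fun t => ‖u t‖) '' Ici 0
  have hne : S.Nonempty := ⟨_, x, hx, rfl⟩
  have hbdd : BddAbove S := ⟨M, by rintro _ ⟨t, ht, rfl⟩; exact (hM t ht).1⟩
  have hle : ∀ t : ℝ, 0 ≤ t → ‖u t‖ ≤ sSup S := fun t ht => le_csSup hbdd ⟨t, ht, rfl⟩
  have hpos : 0 < sSup S := (norm_pos_iff.2 hux).trans_le (hle x hx)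
  -- The pointwise bound is applied with the supremum itself as `M`, so that the same number stands
  -- on both sides and cancels.
  have h : sSup S ≤ sSup S * D / ‖κ‖ := by
    refine csSup_le hne ?_
    rintro _ ⟨t, ht, rfl⟩
    rw [le_div_iff₀ hκ0, mul_comm]
    exact norm_mul_norm_le hκ hD huac hvac hu hw hu0 hle (fun t ht => (hM t ht).2) hint ht
  rw [le_div_iff₀ hκ0] at h
  exact le_of_mul_le_mul_left h hpos

/-! ### From eigenvalues to the final estimate -/

/-- An eigenvalue of the Schrödinger operator has a nontrivial solution of the differential
equation in `L_p`. -/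
theorem IsEigenvalue.exists_solution {p : ℝ≥0∞} {q : ℝ → ℂ} {z : ℂ}
    (h : IsEigenvalue (schrodinger p q) z) :
    ∃ u v : ℝ → ℂ, MemLp u p vol ∧
      (∀ R : ℝ, 0 < R → AbsolutelyContinuousOnInterval u 0 R) ∧
      (∀ R : ℝ, 0 < R → AbsolutelyContinuousOnInterval v 0 R) ∧
      (∀ x ∈ Ici (0 : ℝ), HasDerivWithinAt u (v x) (Ici 0) x) ∧
      (∀ᵐ x ∂vol, HasDerivAt v (q x * u x - z * u x) x) ∧ u 0 = 0 ∧
      ∃ x : ℝ, 0 ≤ x ∧ u x ≠ 0 := by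
  obtain ⟨f, hf0, hf⟩ := h
  have hmem : ((f : Lp ℂ p vol), schrodinger p q f) ∈ dirichletGraph p q := by
    rw [← schrodinger_graph]
    exact (schrodinger p q).mem_graph f
  rw [hf] at hmem
  obtain ⟨u, hfu, v, w, hu, hv, hd, hw, hu0, hg⟩ := hmem
  simp only at hfu hg
  refine ⟨u, v, (memLp_congr_ae hfu).1 (Lp.memLp _), hu, hv, hd, ?_, hu0, ?_⟩
  · filter_upwards [hw, hg, hfu, Lp.coeFn_smul z (f : Lp ℂ p vol)] with x h1 h2 h3 h4
    rw [h4, Pi.smul_apply, h3, smul_eq_mul] at h2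
    rwa [h2, show q x * u x - (-w x + q x * u x) = w x by ring]
  · by_contra! hcon
    refine hf0 ((Lp.eq_zero_iff_ae_eq_zero).2 ?_)
    filter_upwards [hfu, ae_restrict_mem measurableSet_Ioi] with x h1 hx
    rw [h1, hcon x (le_of_lt hx)]
    rfl

/-- The bound for the square root `κ`, with `0 < Im κ`, of an eigenvalue. -/
theorem exists_norm_mul_rpow_le {p r s : ℝ≥0∞} (hp : 1 ≤ p) (hp' : p ≠ ∞) (hr : 0 < r)
    (hs : 0 < s) (hrs : (r⁻¹).toReal + (s⁻¹).toReal < 1) :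
    ∃ C : ℝ, 0 < C ∧ ∀ a b q : ℝ → ℂ, MemWeakLp r a → MemWeakLp s b →
      (∀ᵐ x ∂vol, q x = a x * b x) → ∀ κ : ℂ, 0 < κ.im →
        IsEigenvalue (schrodinger p q) (κ ^ 2) →
          ‖κ‖ * κ.im ^ (1 - (r⁻¹).toReal - (s⁻¹).toReal) ≤
            C * ((wnorm r a).toReal * (wnorm s b).toReal) := by
  obtain ⟨C, hC, H⟩ := exists_setLIntegral_mul_le hr hs hrs
  set γ := 1 - (r⁻¹).toReal - (s⁻¹).toReal with hγ
  have he : 0 < 1 - Real.exp (-1) := by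
    rw [sub_pos, Real.exp_lt_one_iff]; norm_num
  refine ⟨(1 - Real.exp (-1))⁻¹ * C * 2 ^ γ, by positivity,
    fun a b q ha hb hq κ hκ hev => ?_⟩
  obtain ⟨u, v, hLp, hu, hv, hd, hw, hu0, x, hx, hux⟩ := hev.exists_solution
  -- The integral bounds require positive constants, whereas the quasi-norms may vanish; hence the
  -- shift by `ε`, removed in the limit.
  have key : ∀ ε : ℝ, 0 < ε → ‖κ‖ * κ.im ^ γ ≤ (1 - Real.exp (-1))⁻¹ * C * 2 ^ γ *
      (((wnorm r a).toReal + ε) * ((wnorm s b).toReal + ε)) := by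
    intro ε hε
    have hA : 0 < (wnorm r a).toReal + ε := add_pos_of_nonneg_of_pos ENNReal.toReal_nonneg hε
    have hB : 0 < (wnorm s b).toReal + ε := add_pos_of_nonneg_of_pos ENNReal.toReal_nonneg hε
    have hle : ∀ t : ℝ≥0∞, t < ∞ → t ≤ ENNReal.ofReal (t.toReal + ε) := fun t ht => by
      rw [← ENNReal.ofReal_toReal ht.ne, ENNReal.toReal_ofReal ENNReal.toReal_nonneg]
      exact ENNReal.ofReal_le_ofReal (by linarith)
    set P := ((wnorm r a).toReal + ε) * ((wnorm s b).toReal + ε) with hP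
    have hP0 : 0 < P := mul_pos hA hB
    have hqE : ∀ (L : ℝ) (E : Set ℝ), 0 < L → vol E ≤ ENNReal.ofReal L →
        ∫⁻ x in E, ‖q x‖ₑ ∂vol ≤ ENNReal.ofReal (C * P * L ^ γ) := by
      intro L E hL hE
      refine le_trans (le_of_eq (lintegral_congr_ae (ae_restrict_of_ae ?_)))
        (H a b _ _ L E ha.1 hb.1 hA hB hL (hle _ ha.2) (hle _ hb.2) hE)
      filter_upwards [hq] with x hx
      rw [hx]
    obtain ⟨M, hM⟩ := exists_bound_of_memLp hp hp' (K := C * P) (by positivity) hLp hv hd hw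
      (fun c hc => by
        rw [← restrict_vol_Ioc hc]
        have h1 := hqE 1 (Ioc c (c + 1)) one_pos ((vol_le_volume _).trans (by simp))
        rwa [Real.one_rpow, mul_one] at h1)
    have h2 := norm_le_of_solution hκ (by positivity) hu hv hd hw hu0 hM
      (fun x _ => lintegral_exp_mul_le hκ hqE x) hx hux
    rw [Real.div_rpow zero_le_two hκ.le] at h2
    have hδ : 0 < κ.im ^ γ := by positivity
    calc ‖κ‖ * κ.im ^ γ ≤ (1 - Real.exp (-1))⁻¹ * (C * P * (2 ^ γ / κ.im ^ γ)) * κ.im ^ γ := by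
          gcongr
      _ = _ := by field_simp
  have hlim : Filter.Tendsto (fun ε : ℝ => (1 - Real.exp (-1))⁻¹ * C * 2 ^ γ *
      (((wnorm r a).toReal + ε) * ((wnorm s b).toReal + ε))) (nhdsWithin 0 (Ioi 0))
      (nhds ((1 - Real.exp (-1))⁻¹ * C * 2 ^ γ *
        (((wnorm r a).toReal + 0) * ((wnorm s b).toReal + 0)))) :=
    (Continuous.tendsto (by fun_prop) 0).mono_left nhdsWithin_le_nhds
  rw [add_zero, add_zero] at hlim
  exact ge_of_tendsto hlim (Filter.eventually_of_mem self_mem_nhdsWithin key)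

end HalfLine

theorem theorem5 (p r s : ℝ≥0∞) (hp : 1 < p) (hp' : p < ∞) (hr : 0 < r) (hs : p ≤ s)
    (hrs : r⁻¹ + s⁻¹ < 1) (α : ℝ) (hα : α = (1 - (r⁻¹).toReal - (s⁻¹).toReal)⁻¹) :
    ∃ C : ℝ, 0 < C ∧
      ∀ a b q : ℝ → ℂ, HalfLine.MemWeakLp r a → HalfLine.MemWeakLp s b →
        (∀ᵐ x ∂HalfLine.vol, q x = a x * b x) →
        ∀ z : ℂ, ¬ (0 ≤ z.re ∧ z.im = 0) →
          HalfLine.IsEigenvalue (HalfLine.schrodinger p q) z →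
          ∀ θ : ℝ, 0 < θ → θ < 2 * Real.pi → z = ‖z‖ * Complex.exp (θ * Complex.I) →
            ‖z‖ ^ (1 + α) ≤ C * ((α * Real.sin (θ / 2)) ^ 2)⁻¹ *
              (HalfLine.wnorm r a).toReal ^ (2 * α) * (HalfLine.wnorm s b).toReal ^ (2 * α) := by
  have hr1 : r⁻¹ ≠ ∞ := (le_self_add.trans_lt (hrs.trans ENNReal.one_lt_top)).ne
  have hs1 : s⁻¹ ≠ ∞ := (le_add_self.trans_lt (hrs.trans ENNReal.one_lt_top)).ne
  have hrs' : (r⁻¹).toReal + (s⁻¹).toReal < 1 := by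
    rw [← ENNReal.toReal_add hr1 hs1, ← ENNReal.toReal_one]
    exact (ENNReal.toReal_lt_toReal (hrs.trans ENNReal.one_lt_top).ne ENNReal.one_ne_top).2 hrs
  obtain ⟨C, hC, H⟩ := HalfLine.exists_norm_mul_rpow_le hp.le hp'.ne hr
    ((zero_lt_one.trans hp).trans_le hs) hrs'
  set γ := 1 - (r⁻¹).toReal - (s⁻¹).toReal with hγ
  have hγ0 : 0 < γ := by linarith
  have hα0 : 0 < α := by rw [hα]; positivity
  -- The factor `α ^ 2` cancels the `α ^ (-2)` of the stated bound.
  refine ⟨α ^ 2 * C ^ (2 * α), by positivity, fun a b q ha hb hq z hz hev θ hθ hθ' hzθ => ?_⟩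
  have hz0 : 0 < ‖z‖ := norm_pos_iff.2 fun h => hz (by simp [h])
  have hsin : 0 < Real.sin (θ / 2) := Real.sin_pos_of_pos_of_lt_pi (by linarith) (by linarith)
  set k := √‖z‖ with hk
  have hk0 : 0 < k := Real.sqrt_pos.2 hz0
  -- The square root with argument `θ / 2` in `(0, π)`, hence with positive imaginary part.
  set κ : ℂ := k * Complex.exp ((θ / 2 : ℝ) * Complex.I) with hκ
  have hκ2 : κ ^ 2 = z := by
    rw [hκ, mul_pow, ← Complex.exp_nat_mul, ← Complex.ofReal_pow, hk, Real.sq_sqrt hz0.le]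
    conv_rhs => rw [hzθ]
    congr 2
    push_cast
    ring
  have hκn : ‖κ‖ = k := by
    rw [hκ, norm_mul, Complex.norm_exp_ofReal_mul_I, mul_one, Complex.norm_real,
      Real.norm_of_nonneg hk0.le]
  have hκim : κ.im = k * Real.sin (θ / 2) := by
    rw [hκ, Complex.im_ofReal_mul, Complex.exp_ofReal_mul_I_im]
  have h := H a b q ha hb hq κ (by rw [hκim]; positivity) (by rw [hκ2]; exact hev)
  rw [hκn, hκim] at h
  set A := (HalfLine.wnorm r a).toReal with hA
  set B := (HalfLine.wnorm s b).toReal with hB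
  have hA0 : 0 ≤ A := ENNReal.toReal_nonneg
  have hB0 : 0 ≤ B := ENNReal.toReal_nonneg
  -- Since `γ * (2 * α) = 2`, the left side becomes `‖z‖ ^ α * (‖z‖ * sin (θ / 2) ^ 2)`.
  have h1 := Real.rpow_le_rpow (by positivity) h (by positivity : 0 ≤ 2 * α)
  have hγα : γ * (2 * α) = 2 := by rw [hα]; field_simp
  rw [Real.mul_rpow hk0.le (by positivity), ← Real.rpow_mul (by positivity), hγα,
    Real.mul_rpow hC.le (by positivity), Real.mul_rpow hA0 hB0, Real.rpow_two, mul_pow,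
    Real.rpow_mul hk0.le, Real.rpow_two, hk, Real.sq_sqrt hz0.le] at h1
  rw [Real.rpow_add hz0, Real.rpow_one, mul_pow]
  calc ‖z‖ * ‖z‖ ^ α = ‖z‖ ^ α * (‖z‖ * Real.sin (θ / 2) ^ 2) * (Real.sin (θ / 2) ^ 2)⁻¹ := by
        field_simp
    _ ≤ C ^ (2 * α) * (A ^ (2 * α) * B ^ (2 * α)) * (Real.sin (θ / 2) ^ 2)⁻¹ := by gcongr
    _ = _ := by field_simp
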